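/- Let $n \ge 3$ and $k \ge 1$ be integers, and let $PW(n,k)$ be the pinwheel graph, obtained from $k$ disjoint copies of the cycle $C_n$ by identifying one vertex from each copy to a single vertex. The non-backtracking random walk $(X_t)_{t \ge 0}$ on a graph $G$ of minimum degree at least $2$ moves from its starting vertex $X_0$ to a uniformly random neighbor, and at each later step moves from $X_t$ to a uniformly random neighbor of $X_t$ other than $X_{t-1}$. Let $M_v^{(nb)}$ be the matrix, indexed by the vertices of $G = PW(n,k)$, with entries $$\left(M_v^{(nb)}\right)_{ij} = \mathbb{E}\left[\min\{t \ge 0 : X_t = j\} \mid X_0 = i\right] \quad (i \ne j), \qquad \left(M_v^{(nb)}\right)_{ii} = 0,$$ and let $\pi$ be the vector with entries $\pi_i = \deg(i)/(2|E(G)|)$. Then all entries of $M_v^{(nb)}$ are finite and $$\pi^{\top} M_v^{(nb)} \pi = \frac{(n-1)\left(12k^3n - 18k^2n + 13kn - 2k - 4n + 2\right)}{6kn(2k-1)}.$$ -/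

import Mathlib

open MeasureTheory ProbabilityTheory
open scoped ENNReal Matrix

noncomputable section

namespace NBRW

section Walk

variable {V : Type*} [Fintype V] [DecidableEq V] [MeasurableSpace V] [DiscreteMeasurableSpace V]

/-- The vertices available to a non-backtracking walker on `G` that has so far visited
`x 0, …, x t`: all neighbours of the current vertex `x t`, other than the previous vertex
`x (t - 1)` when `t ≥ 1`. -/
def choices (G : SimpleGraph V) [DecidableRel G.Adj] (t : ℕ)
    (x : (s : Finset.Iic t) → V) : Finset V :=
  Finset.univ.filter fun w =>
    G.Adj (x ⟨t, Finset.mem_Iic.2 le_rfl⟩) w ∧ ∀ s : Finset.Iic t, s.1 + 1 = t → w ≠ x s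

/-- The law of the next vertex given the history: uniform on the available vertices.
(In a graph of minimum degree at least two there always are some; at a dead end
the walker is left where it is.) -/
def nextLaw (G : SimpleGraph V) [DecidableRel G.Adj] (t : ℕ)
    (x : (s : Finset.Iic t) → V) : PMF V :=
  if h : (choices G t x).Nonempty then PMF.uniformOfFinset (choices G t x) h
  else PMF.pure (x ⟨t, Finset.mem_Iic.2 le_rfl⟩)

/-- `nextLaw` as a transition kernel from histories to vertices. -/
def step (G : SimpleGraph V) [DecidableRel G.Adj] (t : ℕ) :
    Kernel ((s : Finset.Iic t) → V) V :=
  Kernel.ofFunOfCountable fun x => (nextLaw G t x).toMeasure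

instance (G : SimpleGraph V) [DecidableRel G.Adj] (t : ℕ) : IsMarkovKernel (step G t) :=
  ⟨fun x => PMF.toMeasure.isProbabilityMeasure (nextLaw G t x)⟩

/-- The law, on the space `ℕ → V` of trajectories, of the non-backtracking random walk on `G`
started at the vertex `i`. -/
def walkLaw (G : SimpleGraph V) [DecidableRel G.Adj] (i : V) : Measure (ℕ → V) :=
  Kernel.traj (X := fun _ => V) (step G) 0 (fun _ => i)

/-- The first time at which the trajectory `ω` is at `j` (`∞` if it never is). -/
def hitTime (j : V) (ω : ℕ → V) : ℝ≥0∞ :=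
  ⨅ (t : ℕ) (_ : ω t = j), (t : ℝ≥0∞)

/-- The matrix of mean non-backtracking first hitting times between vertices, with entries in
`[0, ∞]` and with zero diagonal. -/
def hittingMatrix (G : SimpleGraph V) [DecidableRel G.Adj] : Matrix V V ℝ≥0∞ :=
  Matrix.of fun i j => if i = j then 0 else ∫⁻ ω, hitTime j ω ∂(walkLaw G i)

end Walk

/-- The stationary distribution `π i = deg i / (2 |E|)` of the random walk on `G`. -/
def stationary {V : Type*} [Fintype V] (G : SimpleGraph V) [DecidableRel G.Adj] : V → ℝ :=
  fun i => (G.degree i : ℝ) / (2 * (G.edgeFinset.card : ℝ))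

/-- The vertices of the pinwheel: the hub `none`, and the non-hub vertices `some (l, a)`,
`a ≠ 0`, of the `l`-th copy of the cycle on `Fin n`. -/
abbrev PinwheelVertex (n k : ℕ) : Type := Option (Fin k × {a : Fin n // a.val ≠ 0})

instance (n k : ℕ) : MeasurableSpace (PinwheelVertex n k) := ⊤

instance (n k : ℕ) : DiscreteMeasurableSpace (PinwheelVertex n k) := ⟨fun _ => trivial⟩

/-- The vertex of the pinwheel that comes from the vertex `a` of the `l`-th cycle; the vertices
`0` of all the cycles are identified. -/
def glue {n k : ℕ} (l : Fin k) (a : Fin n) : PinwheelVertex n k :=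
  if h : a.val = 0 then none else some (l, ⟨a, h⟩)

theorem glue_injective {n k : ℕ} (l : Fin k) :
    Function.Injective (glue l : Fin n → PinwheelVertex n k) := by
  intro a b h
  by_cases h1 : a.val = 0 <;> by_cases h2 : b.val = 0
  · exact Fin.ext (h1.trans h2.symm)
  · simp [glue, h1, h2] at h
  · simp [glue, h1, h2] at h
  · simpa [glue, h1, h2] using h

/-- The pinwheel `PW(n, k)`: `k` copies of the cycle `C_n` glued together at one vertex. -/
def pinwheel (n k : ℕ) : SimpleGraph (PinwheelVertex n k) where
  Adj x y := ∃ (l : Fin k) (a b : Fin n),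
    (SimpleGraph.cycleGraph n).Adj a b ∧ x = glue l a ∧ y = glue l b
  symm := ⟨by
    rintro x y ⟨l, a, b, h, hx, hy⟩
    exact ⟨l, b, a, h.symm, hy, hx⟩⟩
  loopless := ⟨by
    rintro x ⟨l, a, b, h, hx, hy⟩
    exact h.ne (glue_injective l (hx.symm.trans hy))⟩

instance (n k : ℕ) : DecidableRel (pinwheel n k).Adj := fun x y =>
  inferInstanceAs (Decidable (∃ (l : Fin k) (a b : Fin n),
    (SimpleGraph.cycleGraph n).Adj a b ∧ x = glue l a ∧ y = glue l b))

end NBRW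

end

/-! The non-backtracking walk is Markov on arcs, and inside a cycle it has no choice: it keeps its
direction until it reaches the hub. Randomness enters only at the first step and at the hub, where
the walker picks one of the 2k - 1 arcs other than the reverse of its arrival arc. For a fixed
target, the mean remaining time as a function of the last arc traversed is therefore affine along
each stretch of cycle, and the equations at the hub fix the constants.
`lintegral_hitTime_of_firstStep` shows that any finite solution of the first-step equations on arcs
gives the true mean hitting times, so it is enough to exhibit solutions: `isArcSolution_hub` and
`isArcSolution_pos`.

Averaging over the first step gives n/2 to the hub, n/(2k) + (k-1)n from the hub, n/2 + (k-1)n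
between distinct cycles, and within one cycle a value that depends only on the target and on the
side of it where the walk starts. Since π is 1/n at the hub and 1/(kn) elsewhere, the bilinear form
reduces to a few sums. Only the one within a cycle is not over a constant, and it becomes the sum of
a quadratic polynomial (`sum_hittingMatrix_same`). -/

namespace NBRW

/-! ### Law of the walk on a general graph -/

section General

variable {V : Type*} [Fintype V] [DecidableEq V] [MeasurableSpace V] [DiscreteMeasurableSpace V]
  (G : SimpleGraph V) [DecidableRel G.Adj]

omit [MeasurableSpace V] [DiscreteMeasurableSpace V] in
theorem choices_zero (x : (s : Finset.Iic 0) → V) :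
    choices G 0 x = G.neighborFinset (x ⟨0, Finset.mem_Iic.2 le_rfl⟩) := by
  ext w
  simp [choices]

omit [MeasurableSpace V] [DiscreteMeasurableSpace V] in
theorem choices_succ (t : ℕ) (x : (s : Finset.Iic (t + 1)) → V) :
    choices G (t + 1) x = (G.neighborFinset (x ⟨t + 1, Finset.mem_Iic.2 le_rfl⟩)).erase
      (x ⟨t, Finset.mem_Iic.2 t.le_succ⟩) := by
  ext w
  simp only [choices, Finset.mem_filter, Finset.mem_univ, true_and, Finset.mem_erase,
    SimpleGraph.mem_neighborFinset, Subtype.forall]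
  constructor
  · rintro ⟨h1, h2⟩
    exact ⟨h2 t (Finset.mem_Iic.2 t.le_succ) rfl, h1⟩
  · rintro ⟨h1, h2⟩
    refine ⟨h2, fun s hs hst => ?_⟩
    obtain rfl : s = t := by omega
    exact h1

/-- The expectation of a function of the next vertex is its average over the available ones. -/
theorem lintegral_nextLaw (t : ℕ) (x : (s : Finset.Iic t) → V) (h : (choices G t x).Nonempty)
    (g : V → ℝ≥0∞) :
    ∫⁻ w, g w ∂(nextLaw G t x).toMeasure =
      (∑ w ∈ choices G t x, g w) / ((choices G t x).card : ℝ≥0∞) := by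
  rw [lintegral_fintype, nextLaw, dif_pos h]
  simp only [PMF.toMeasure_apply_singleton _ _ (measurableSet_singleton _),
    PMF.uniformOfFinset_apply, mul_ite, mul_zero]
  rw [← Finset.sum_filter, Finset.filter_mem_eq_inter, Finset.univ_inter, ENNReal.div_eq_inv_mul,
    Finset.mul_sum]
  exact Finset.sum_congr rfl fun w _ => mul_comm _ _

instance (i : V) : IsProbabilityMeasure (walkLaw G i) := by
  unfold walkLaw
  infer_instance

omit [DecidableEq V] in
/-- The Markov property: the next point of a trajectory may be averaged over the kernel. -/
theorem lintegral_traj_step (κ : (t : ℕ) → Kernel ((s : Finset.Iic t) → V) V)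
    [∀ t, IsMarkovKernel (κ t)] (x₀ : (s : Finset.Iic 0) → V) (t : ℕ)
    (h : ((s : Finset.Iic t) → V) → V → ℝ≥0∞) :
    ∫⁻ ω, h (Preorder.frestrictLe t ω) (ω (t + 1)) ∂(Kernel.traj (X := fun _ => V) κ 0 x₀) =
      ∫⁻ ω, ∫⁻ w, h (Preorder.frestrictLe t ω) w ∂(κ t (Preorder.frestrictLe t ω))
        ∂(Kernel.traj (X := fun _ => V) κ 0 x₀) := by
  have hm : Measurable (Function.uncurry h) := Measurable.of_discrete
  have hm' : Measurable fun x => ∫⁻ w, h x w ∂(κ t x) := Measurable.of_discrete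
  have h1 := lintegral_map (μ := Kernel.traj (X := fun _ => V) κ 0 x₀) hm
    (g := fun ω : ℕ → V => (Preorder.frestrictLe (π := fun _ => V) t ω, ω (t + 1))) (by fun_prop)
  have h2 := lintegral_map (μ := Kernel.traj (X := fun _ => V) κ 0 x₀) hm'
    (Preorder.measurable_frestrictLe (X := fun _ => V) t)
  rw [Kernel.traj_map_frestrictLe_apply] at h2
  -- The joint law of the history up to t and the next point is the composition-product of the
  -- history's law with `κ t`.
  rw [← Kernel.partialTraj_compProd_eq_map_traj (Nat.zero_le t), Measure.lintegral_compProd hm] at h1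
  exact h1.symm.trans h2

/-- The Markov property: the next vertex may be averaged over `nextLaw`. -/
theorem lintegral_walkLaw_step (i : V) (t : ℕ) (h : ((s : Finset.Iic t) → V) → V → ℝ≥0∞) :
    ∫⁻ ω, h (Preorder.frestrictLe t ω) (ω (t + 1)) ∂(walkLaw G i) =
      ∫⁻ ω, ∫⁻ w, h (Preorder.frestrictLe t ω) w
        ∂(nextLaw G t (Preorder.frestrictLe t ω)).toMeasure ∂(walkLaw G i) :=
  lintegral_traj_step (step G) (fun _ => i) t h

theorem walkLaw_start (i : V) : ∀ᵐ ω ∂(walkLaw G i), ω 0 = i := by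
  have h := Kernel.traj_map_frestrictLe_apply (X := fun _ => V) (κ := step G) 0 0 (fun _ => i)
  rw [Kernel.partialTraj_self, Kernel.id_apply] at h
  have h2 : ∀ᵐ x ∂((walkLaw G i).map (Preorder.frestrictLe (π := fun _ => V) 0)),
      x ⟨0, Finset.mem_Iic.2 le_rfl⟩ = i := by
    rw [walkLaw, h, ae_dirac_eq]
    simp
  exact ae_of_ae_map (by fun_prop) h2

variable (hV : ∀ i, (G.neighborFinset i).Nonempty)
  (hne : ∀ u v, G.Adj u v → ((G.neighborFinset v).erase u).Nonempty)

include hV in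
theorem lintegral_walkLaw_zero (i : V) (g : V → V → ℝ≥0∞) :
    ∫⁻ ω, g (ω 0) (ω 1) ∂(walkLaw G i) =
      (∑ w ∈ G.neighborFinset i, g i w) / ((G.neighborFinset i).card : ℝ≥0∞) := by
  have h := lintegral_walkLaw_step G i 0 fun x w => g (x ⟨0, Finset.mem_Iic.2 le_rfl⟩) w
  refine h.trans ?_
  have hc : ∀ᵐ ω ∂(walkLaw G i), ∫⁻ w, g (ω 0) w
      ∂(nextLaw G 0 (Preorder.frestrictLe 0 ω)).toMeasure =
        (∑ w ∈ G.neighborFinset i, g i w) / ((G.neighborFinset i).card : ℝ≥0∞) := by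
    filter_upwards [walkLaw_start G i] with ω hω
    have hch : choices G 0 (Preorder.frestrictLe 0 ω) = G.neighborFinset i := by
      rw [choices_zero, ← hω]
      rfl
    rw [lintegral_nextLaw G _ _ (by rw [hch]; exact hV i), hch, hω]
  refine (lintegral_congr_ae hc).trans ?_
  simp

-- By induction on time: if the last step was along an edge, `hne` leaves an available vertex, so
-- the dead-end branch of `nextLaw` is not taken and the next step is along an edge too. The
-- induction is run on the integral of the indicator of a non-edge.
include hV hne in
theorem walkLaw_adj (i : V) (t : ℕ) : ∀ᵐ ω ∂(walkLaw G i), G.Adj (ω t) (ω (t + 1)) := by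
  have hm : ∀ t, Measurable fun ω : ℕ → V => (if G.Adj (ω t) (ω (t + 1)) then 0 else 1 : ℝ≥0∞) :=
    fun t => Measurable.comp (g := fun p : V × V => (if G.Adj p.1 p.2 then 0 else 1 : ℝ≥0∞))
      (f := fun ω : ℕ → V => (ω t, ω (t + 1))) Measurable.of_discrete (by fun_prop)
  have hz : ∫⁻ ω, (if G.Adj (ω t) (ω (t + 1)) then 0 else 1) ∂(walkLaw G i) = 0 := by
    induction t with
    | zero =>
      rw [lintegral_walkLaw_zero G hV i fun u v => if G.Adj u v then 0 else 1]
      rw [Finset.sum_eq_zero]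
      · simp
      · intro w hw
        simpa using hw
    | succ t ih =>
      rw [lintegral_eq_zero_iff (hm t)] at ih
      refine (lintegral_walkLaw_step G i (t + 1) fun x w =>
        if G.Adj (x ⟨t + 1, Finset.mem_Iic.2 le_rfl⟩) w then 0 else 1).trans ?_
      rw [lintegral_eq_zero_of_ae_eq_zero]
      filter_upwards [ih] with ω hω
      have ha : G.Adj (ω t) (ω (t + 1)) := by
        by_contra hcon
        simp [hcon] at hω
      have hch : choices G (t + 1) (Preorder.frestrictLe (t + 1) ω) =
          (G.neighborFinset (ω (t + 1))).erase (ω t) := choices_succ G t _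
      rw [lintegral_nextLaw G _ _ (by rw [hch]; exact hne _ _ ha), hch, Finset.sum_eq_zero]
      · simp
      · intro w hw
        have hw' : G.Adj (ω (t + 1)) w := by simpa using Finset.mem_of_mem_erase hw
        exact if_pos hw'
  rw [lintegral_eq_zero_iff (hm t)] at hz
  filter_upwards [hz] with ω hω
  by_contra hcon
  simp [hcon] at hω

/-! ### Hitting times and first-step analysis -/

/-- The trajectories that avoid `j` up to time `t`. -/
def avoiding (j : V) (t : ℕ) : Set (ℕ → V) := {ω | ∀ s ≤ t, ω s ≠ j}

omit [Fintype V] [DecidableEq V] in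
theorem measurableSet_avoiding (j : V) (t : ℕ) : MeasurableSet (avoiding j t) := by
  have : avoiding j t = ⋂ s ∈ Set.Iic t, {ω : ℕ → V | ω s = j}ᶜ := by
    ext ω
    simp [avoiding]
  rw [this]
  refine MeasurableSet.biInter (Set.to_countable _) fun s _ => MeasurableSet.compl ?_
  exact (measurable_pi_apply s : Measurable fun ω : ℕ → V => ω s)
    (MeasurableSet.of_discrete (s := {j}))

omit [Fintype V] [DecidableEq V] [MeasurableSpace V] [DiscreteMeasurableSpace V] in
/-- The hitting time counts the times up to which the trajectory avoids `j`. -/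
theorem hitTime_eq_tsum (j : V) (ω : ℕ → V) :
    hitTime j ω = ∑' t, (avoiding j t).indicator 1 ω := by
  classical
  by_cases h : ∃ t, ω t = j
  · have h1 : hitTime j ω = (Nat.find h : ℝ≥0∞) := by
      refine le_antisymm (iInf₂_le (Nat.find h) (Nat.find_spec h)) (le_iInf₂ fun t ht => ?_)
      exact_mod_cast Nat.find_min' h ht
    rw [h1, tsum_eq_sum (s := Finset.range (Nat.find h))]
    · rw [Finset.sum_congr rfl (g := fun _ => 1)]
      · simp
      · intro t ht
        rw [Set.indicator_of_mem, Pi.one_apply]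
        intro s hs
        exact Nat.find_min h (hs.trans_lt (Finset.mem_range.1 ht))
    · intro t ht
      rw [Set.indicator_of_notMem]
      intro hcon
      exact hcon _ (by simpa using ht) (Nat.find_spec h)
  · push Not at h
    have h1 : hitTime j ω = ⊤ := by simp [hitTime, h]
    rw [h1, eq_comm, tsum_congr (g := fun _ => 1)]
    · exact ENNReal.tsum_const_eq_top_of_ne_zero one_ne_zero
    · intro t
      rw [Set.indicator_of_mem, Pi.one_apply]
      exact fun s _ => h s

theorem lintegral_hitTime (i j : V) :
    ∫⁻ ω, hitTime j ω ∂(walkLaw G i) = ∑' t, walkLaw G i (avoiding j t) := by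
  simp_rw [hitTime_eq_tsum]
  rw [lintegral_tsum fun t => (measurable_one.indicator (measurableSet_avoiding j t)).aemeasurable]
  exact tsum_congr fun t => lintegral_indicator_one (measurableSet_avoiding j t)

include hV hne in
/-- First-step analysis for the non-backtracking walk: a finite solution `f` of the first-step
equations on the arcs determines the mean hitting times. -/
theorem lintegral_hitTime_of_firstStep {i j : V} (hij : i ≠ j) (f : V → V → ℝ≥0∞)
    (hfin : ∀ u v, f u v ≠ ⊤) (h0 : ∀ u, G.Adj u j → f u j = 0)
    (hf : ∀ u v, G.Adj u v → v ≠ j → f u v = 1 + (∑ w ∈ (G.neighborFinset v).erase u, f v w) /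
      (((G.neighborFinset v).erase u).card : ℝ≥0∞)) :
    ∫⁻ ω, hitTime j ω ∂(walkLaw G i) =
      1 + (∑ w ∈ G.neighborFinset i, f i w) / ((G.neighborFinset i).card : ℝ≥0∞) := by
  classical
  set ν := walkLaw G i with hν
  -- If f is the remaining time counted from the head of an arc, `b t` is the mean time still needed
  -- after time t + 1, restricted to walks that avoid j up to time t.
  set b : ℕ → ℝ≥0∞ := fun t => ∫⁻ ω, (avoiding j t).indicator 1 ω * f (ω t) (ω (t + 1)) ∂ν with hb
  have hstart := walkLaw_start G i
  have hp0 : ν (avoiding j 0) = 1 := by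
    rw [prob_compl_eq_zero_iff (measurableSet_avoiding j 0) |>.symm]
    refine measure_mono_null (t := {ω | ¬ ω 0 = i}) (fun ω hω hω0 => hω fun s hs => ?_) hstart
    obtain rfl : s = 0 := by omega
    exact hω0 ▸ hij
  have hb0 : b 0 = (∑ w ∈ G.neighborFinset i, f i w) / ((G.neighborFinset i).card : ℝ≥0∞) := by
    rw [← lintegral_walkLaw_zero G hV i f]
    refine lintegral_congr_ae ?_
    filter_upwards [hstart] with ω hω
    rw [Set.indicator_of_mem]
    · simp
    · intro s hs
      obtain rfl : s = 0 := by omega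
      exact hω ▸ hij
  -- If the walk is at j at time t + 1, then f vanishes on the arc just used; otherwise the
  -- first-step equation contributes 1 plus the next average. The identity is additive because
  -- subtraction in `ℝ≥0∞` is truncated.
  have hstep : ∀ t, b t = ν (avoiding j (t + 1)) + b (t + 1) := by
    intro t
    have h1 : b (t + 1) = ∫⁻ ω, (avoiding j (t + 1)).indicator 1 ω *
        ((∑ w ∈ (G.neighborFinset (ω (t + 1))).erase (ω t), f (ω (t + 1)) w) /
          (((G.neighborFinset (ω (t + 1))).erase (ω t)).card : ℝ≥0∞)) ∂ν := by
      -- The avoidance event is read off the history, so that the Markov property applies.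
      have hind : ∀ ω : ℕ → V, (avoiding j (t + 1)).indicator (1 : (ℕ → V) → ℝ≥0∞) ω =
          if ∀ s, Preorder.frestrictLe (t + 1) ω s ≠ j then 1 else 0 := by
        intro ω
        simp [Set.indicator_apply, avoiding]
      have h2 := lintegral_walkLaw_step G i (t + 1) fun x w =>
        (if ∀ s, x s ≠ j then 1 else 0) * f (x ⟨t + 1, Finset.mem_Iic.2 le_rfl⟩) w
      simp only [hb, hind]
      refine h2.trans (lintegral_congr_ae ?_)
      filter_upwards [walkLaw_adj G hV hne i t] with ω hω
      have hch : choices G (t + 1) (Preorder.frestrictLe (t + 1) ω) =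
          (G.neighborFinset (ω (t + 1))).erase (ω t) := choices_succ G t _
      rw [lintegral_const_mul _ Measurable.of_discrete,
        lintegral_nextLaw G _ _ (by rw [hch]; exact hne _ _ hω), hch]
      rfl
    rw [h1, ← lintegral_indicator_one (measurableSet_avoiding j (t + 1)),
      ← lintegral_add_left (measurable_one.indicator (measurableSet_avoiding j (t + 1)))]
    refine lintegral_congr_ae ?_
    filter_upwards [walkLaw_adj G hV hne i t] with ω hω
    by_cases hj : ω (t + 1) = j
    · have : ω ∉ avoiding j (t + 1) := fun hcon => hcon _ le_rfl hj
      have hzero := h0 (ω t) (hj ▸ hω)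
      simp [this, hj, hzero]
    · have : ω ∈ avoiding j (t + 1) ↔ ω ∈ avoiding j t := by
        refine ⟨fun h s hs => h s (by omega), fun h s hs => ?_⟩
        rcases Nat.le_succ_iff.1 hs with h' | rfl
        exacts [h s h', hj]
      rw [hf _ _ hω hj]
      by_cases hω' : ω ∈ avoiding j t
      · simp [hω', this.2 hω']
      · simp [hω', this]
  have hsum : ∀ T, 1 + b 0 = ∑ t ∈ Finset.range (T + 1), ν (avoiding j t) + b T := by
    intro T
    induction T with
    | zero => simp [hp0]
    | succ T ih => rw [ih, hstep T, Finset.sum_range_succ _ (T + 1), add_assoc]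
  have hb0fin : b 0 ≠ ⊤ := by
    rw [hb0]
    refine ENNReal.div_ne_top (ENNReal.sum_ne_top.2 fun w _ => hfin i w) ?_
    exact_mod_cast (hV i).card_pos.ne'
  -- Telescoping bounds the partial sums by the finite number 1 + b 0. Hence the avoidance
  -- probabilities tend to 0, and so does the remainder `b T`, because f is bounded by C.
  have hle : ∑' t, ν (avoiding j t) ≤ 1 + b 0 := by
    rw [ENNReal.tsum_eq_iSup_nat]
    refine iSup_le fun T => ?_
    rw [hsum T]
    exact (Finset.sum_le_sum_of_subset (Finset.range_mono T.le_succ)).trans le_self_add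
  have hfinsum : ∑' t, ν (avoiding j t) ≠ ⊤ :=
    ne_top_of_le_ne_top (ENNReal.add_ne_top.2 ⟨ENNReal.one_ne_top, hb0fin⟩) hle
  set C : ℝ≥0∞ := ∑ u, ∑ v, f u v with hC
  have hCfin : C ≠ ⊤ := ENNReal.sum_ne_top.2 fun u _ => ENNReal.sum_ne_top.2 fun v _ => hfin u v
  have hbC : ∀ t, b t ≤ ν (avoiding j t) * C := by
    intro t
    rw [← lintegral_indicator_one (measurableSet_avoiding j t),
      ← lintegral_mul_const _ (measurable_one.indicator (measurableSet_avoiding j t))]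
    refine lintegral_mono fun ω => mul_le_mul_right ?_ _
    exact (Finset.single_le_sum (f := fun v => f (ω t) v) (fun _ _ => zero_le) (Finset.mem_univ _)).trans
      (Finset.single_le_sum (f := fun u => ∑ v, f u v) (fun _ _ => zero_le) (Finset.mem_univ _))
  have hblim : Filter.Tendsto b Filter.atTop (nhds 0) := by
    have h1 := ENNReal.Tendsto.mul_const (b := C)
      (ENNReal.tendsto_atTop_zero_of_tsum_ne_top hfinsum) (Or.inr hCfin)
    rw [zero_mul] at h1
    exact tendsto_of_tendsto_of_tendsto_of_le_of_le tendsto_const_nhds h1 (fun _ => zero_le) hbC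
  rw [lintegral_hitTime, ← hb0]
  have hlim := ((ENNReal.tendsto_nat_tsum fun t => ν (avoiding j t)).comp
    (Filter.tendsto_add_atTop_nat 1)).add hblim
  rw [add_zero] at hlim
  refine tendsto_nhds_unique hlim ?_
  refine tendsto_const_nhds.congr fun T => hsum T

include hV hne in
/-- First-step analysis with real-valued solutions. -/
theorem hittingMatrix_of_firstStep {i j : V} (hij : i ≠ j) (f : V → V → ℝ)
    (hnonneg : ∀ u v, 0 ≤ f u v) (h0 : ∀ u, G.Adj u j → f u j = 0)
    (hf : ∀ u v, G.Adj u v → v ≠ j → f u v = 1 + (∑ w ∈ (G.neighborFinset v).erase u, f v w) /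
      (((G.neighborFinset v).erase u).card : ℝ)) :
    hittingMatrix G i j =
      ENNReal.ofReal (1 + (∑ w ∈ G.neighborFinset i, f i w) / ((G.neighborFinset i).card : ℝ)) := by
  have key : ∀ (s : Finset V) (g : V → ℝ), s.Nonempty → (∀ w, 0 ≤ g w) →
      ENNReal.ofReal (1 + (∑ w ∈ s, g w) / (s.card : ℝ)) =
        1 + (∑ w ∈ s, ENNReal.ofReal (g w)) / (s.card : ℝ≥0∞) := by
    intro s g hs hg
    rw [ENNReal.ofReal_add zero_le_one (div_nonneg (Finset.sum_nonneg fun w _ => hg w)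
      (Nat.cast_nonneg _)), ENNReal.ofReal_one,
      ENNReal.ofReal_div_of_pos (by exact_mod_cast hs.card_pos), ENNReal.ofReal_natCast,
      ENNReal.ofReal_sum_of_nonneg fun w _ => hg w]
  rw [hittingMatrix, Matrix.of_apply, if_neg hij, key _ _ (hV i) (hnonneg i)]
  refine lintegral_hitTime_of_firstStep G hV hne hij (fun u v => ENNReal.ofReal (f u v))
    (fun _ _ => ENNReal.ofReal_ne_top) (fun u hu => by simp [h0 u hu]) fun u v huv hv => ?_
  rw [hf u v huv hv, key _ _ (hne u v huv) (hnonneg v)]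

end General

/-! ### Coordinates and neighbourhoods in the pinwheel -/

section Pinwheel

variable {n k : ℕ}

/-- The vertex at distance `m` along the `l`-th cycle from the hub, for `m ≤ n`; both `m = 0` and
`m = n` give the hub. -/
def pos (l : Fin k) (m : ℕ) : PinwheelVertex n k :=
  if h : 0 < m ∧ m < n then some (l, ⟨⟨m, h.2⟩, h.1.ne'⟩) else none

theorem pos_zero (l : Fin k) : (pos l 0 : PinwheelVertex n k) = none := by simp [pos]

theorem pos_self (l : Fin k) : (pos l n : PinwheelVertex n k) = none := by simp [pos]

theorem pos_val (l : Fin k) (a : {a : Fin n // a.val ≠ 0}) :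
    (pos l a.1.1 : PinwheelVertex n k) = some (l, a) :=
  dif_pos ⟨Nat.pos_of_ne_zero a.2, a.1.2⟩

theorem pos_eq_none {l : Fin k} {m : ℕ} (hm : m ≤ n) :
    (pos l m : PinwheelVertex n k) = none ↔ m = 0 ∨ m = n := by
  rw [pos]
  split_ifs with h
  · simp; omega
  · simp; omega

theorem pos_eq_pos {l l' : Fin k} {m m' : ℕ} (h0 : 0 < m) (hm : m < n) :
    (pos l m : PinwheelVertex n k) = pos l' m' ↔ l = l' ∧ m = m' := by
  rw [pos, dif_pos ⟨h0, hm⟩, pos]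
  split_ifs with h
  · simp
  · simp only [false_iff]
    rintro ⟨-, rfl⟩
    exact h ⟨h0, hm⟩

theorem glue_eq_pos (l : Fin k) (a : Fin n) : glue l a = pos l a.1 := by
  by_cases h : a.1 = 0
  · simp [glue, pos, h]
  · simp [glue, pos, h, Nat.pos_of_ne_zero h]

/-- Subtraction in `Fin n` is cyclic; the wrap-around case holds because positions 0 and n are both
the hub. -/
theorem pos_of_sub_val_eq_one (l : Fin k) {a b : Fin n} (h : (b - a).val = 1) :
    (pos l b.1 : PinwheelVertex n k) = pos l (a.1 + 1) := by
  have ha := a.2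
  have hb := b.2
  rw [Fin.val_sub] at h
  rcases lt_or_ge (n - a.1 + b.1) n with h1 | h1
  · rw [Nat.mod_eq_of_lt h1] at h
    have e1 : b.1 = 0 := by omega
    have e2 : a.1 + 1 = n := by omega
    rw [e1, e2, pos_zero, pos_self]
  · rw [Nat.mod_eq_sub_mod h1, Nat.mod_eq_of_lt (by omega)] at h
    have e1 : b.1 = a.1 + 1 := by omega
    rw [e1]

theorem sub_val_eq_one (hn : 3 ≤ n) {m : ℕ} (hm : m < n) :
    ((⟨(m + 1) % n, Nat.mod_lt _ (by omega)⟩ : Fin n) - ⟨m, hm⟩).val = 1 := by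
  rw [Fin.val_sub]
  rcases Nat.lt_or_ge (m + 1) n with h | h
  · simp only [Nat.mod_eq_of_lt h]
    rw [show n - m + (m + 1) = 1 + n by omega, Nat.add_mod_right, Nat.mod_eq_of_lt (by omega)]
  · obtain rfl : n = m + 1 := by omega
    simp only [Nat.mod_self]
    rw [Nat.mod_eq_of_lt (by omega)]
    omega

theorem pos_succ_mod (l : Fin k) {m : ℕ} (hm : m < n) :
    (pos l ((m + 1) % n) : PinwheelVertex n k) = pos l (m + 1) := by
  rcases Nat.lt_or_ge (m + 1) n with h | h
  · rw [Nat.mod_eq_of_lt h]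
  · obtain rfl : n = m + 1 := by omega
    rw [Nat.mod_self, pos_zero, pos_self]

theorem pinwheel_adj_iff (hn : 3 ≤ n) {u v : PinwheelVertex n k} :
    (pinwheel n k).Adj u v ↔ ∃ (l : Fin k) (m : ℕ), m < n ∧
      ((u = pos l m ∧ v = pos l (m + 1)) ∨ (u = pos l (m + 1) ∧ v = pos l m)) := by
  constructor
  · rintro ⟨l, a, b, h, rfl, rfl⟩
    rw [SimpleGraph.cycleGraph_adj'] at h
    rw [glue_eq_pos, glue_eq_pos]
    rcases h with h | h
    · exact ⟨l, b.1, b.2, Or.inr ⟨pos_of_sub_val_eq_one l h, rfl⟩⟩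
    · exact ⟨l, a.1, a.2, Or.inl ⟨rfl, pos_of_sub_val_eq_one l h⟩⟩
  · have key : ∀ (l : Fin k) (m : ℕ), m < n →
        (pinwheel n k).Adj (pos l m) (pos l (m + 1)) := fun l m hm =>
      ⟨l, ⟨m, hm⟩, ⟨(m + 1) % n, Nat.mod_lt _ (by omega)⟩,
        SimpleGraph.cycleGraph_adj'.2 (Or.inr (sub_val_eq_one hn hm)),
        by rw [glue_eq_pos], by rw [glue_eq_pos, pos_succ_mod l hm]⟩
    rintro ⟨l, m, hm, ⟨rfl, rfl⟩ | ⟨rfl, rfl⟩⟩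
    · exact key l m hm
    · exact (key l m hm).symm

theorem neighborFinset_pos (hn : 3 ≤ n) (l : Fin k) {m : ℕ} (hm : m + 1 < n) :
    (pinwheel n k).neighborFinset (pos l (m + 1)) = {pos l m, pos l (m + 2)} := by
  ext w
  rw [SimpleGraph.mem_neighborFinset, pinwheel_adj_iff hn, Finset.mem_insert, Finset.mem_singleton]
  constructor
  · rintro ⟨l', m', hm', ⟨h, rfl⟩ | ⟨h, rfl⟩⟩ <;>
    · rw [pos_eq_pos (Nat.succ_pos m) hm] at h
      obtain ⟨rfl, h⟩ := h
      first
        | (obtain rfl : m' = m + 1 := by omega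
           exact Or.inr rfl)
        | (obtain rfl : m' = m := by omega
           exact Or.inl rfl)
  · rintro (rfl | rfl)
    · exact ⟨l, m, by omega, Or.inr ⟨rfl, rfl⟩⟩
    · exact ⟨l, m + 1, by omega, Or.inl ⟨rfl, rfl⟩⟩

theorem pos_ne_pos_add_two (hn : 3 ≤ n) (l : Fin k) {m : ℕ} (hm : m + 1 < n) :
    (pos l m : PinwheelVertex n k) ≠ pos l (m + 2) := by
  rcases Nat.eq_zero_or_pos m with rfl | h
  · rw [pos_zero, ne_comm, Ne, pos_eq_none (by omega)]
    omega
  · rw [Ne, pos_eq_pos h (by omega)]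
    omega

theorem neighborFinset_hub (hn : 3 ≤ n) :
    (pinwheel n k).neighborFinset none =
      Finset.univ.biUnion fun l : Fin k => {pos l 1, pos l (n - 1)} := by
  ext w
  simp only [SimpleGraph.mem_neighborFinset, pinwheel_adj_iff hn, Finset.mem_biUnion,
    Finset.mem_univ, true_and, Finset.mem_insert, Finset.mem_singleton]
  constructor
  · rintro ⟨l, m, hm, ⟨h, rfl⟩ | ⟨h, rfl⟩⟩
    · obtain rfl | rfl := (pos_eq_none (by omega)).1 h.symm
      · exact ⟨l, Or.inl rfl⟩
      · omega
    · obtain h | h := (pos_eq_none (by omega)).1 h.symm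
      · omega
      · exact ⟨l, Or.inr (by rw [← h]; rfl)⟩
  · rintro ⟨l, rfl | rfl⟩
    · exact ⟨l, 0, by omega, Or.inl ⟨(pos_zero l).symm, rfl⟩⟩
    · refine ⟨l, n - 1, by omega, Or.inr ⟨?_, rfl⟩⟩
      rw [Nat.sub_add_cancel (by omega), pos_self]

theorem sum_neighborFinset_hub (hn : 3 ≤ n) {M : Type*} [AddCommMonoid M]
    (g : PinwheelVertex n k → M) :
    ∑ w ∈ (pinwheel n k).neighborFinset none, g w = ∑ l, (g (pos l 1) + g (pos l (n - 1))) := by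
  rw [neighborFinset_hub hn, Finset.sum_biUnion]
  · refine Finset.sum_congr rfl fun l _ => Finset.sum_pair ?_
    rw [Ne, pos_eq_pos one_pos (by omega)]
    omega
  · intro l _ l' _ hl
    rw [Function.onFun, Finset.disjoint_left]
    intro w hw hw'
    simp only [Finset.mem_insert, Finset.mem_singleton] at hw hw'
    rcases hw with rfl | rfl <;> rcases hw' with h | h <;>
      exact hl ((pos_eq_pos (by omega) (by omega)).1 h).1

theorem card_neighborFinset_hub (hn : 3 ≤ n) :
    ((pinwheel n k).neighborFinset none).card = 2 * k := by
  rw [Finset.card_eq_sum_ones, sum_neighborFinset_hub hn]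
  simp [mul_comm]

theorem card_neighborFinset_pos (hn : 3 ≤ n) (l : Fin k) {m : ℕ} (hm : m + 1 < n) :
    ((pinwheel n k).neighborFinset (pos l (m + 1))).card = 2 := by
  rw [neighborFinset_pos hn l hm, Finset.card_pair (pos_ne_pos_add_two hn l hm)]

theorem eq_none_or_pos (v : PinwheelVertex n k) :
    v = none ∨ ∃ (l : Fin k) (m : ℕ), m + 1 < n ∧ v = pos l (m + 1) := by
  rcases v with _ | ⟨l, a⟩
  · exact Or.inl rfl
  · have h0 := a.2
    have h1 := a.1.2
    refine Or.inr ⟨l, a.1.1 - 1, by omega, ?_⟩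
    rw [Nat.sub_add_cancel (by omega), pos_val]

theorem two_le_card_neighborFinset (hn : 3 ≤ n) (hk : 1 ≤ k) (v : PinwheelVertex n k) :
    2 ≤ ((pinwheel n k).neighborFinset v).card := by
  obtain rfl | ⟨l, m, hm, rfl⟩ := eq_none_or_pos v
  · rw [card_neighborFinset_hub hn]
    omega
  · rw [card_neighborFinset_pos hn l hm]

/-! ### First-step equations on the arcs of the pinwheel -/

/-- The function on arcs with value `P l m` on the arc from position `m - 1` to position `m` of the
`l`-th cycle, and `Q l m` on the arc from position `m + 1` to position `m`. -/
def arcFun (P Q : Fin k → ℕ → ℝ) : PinwheelVertex n k → PinwheelVertex n k → ℝ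
  | none, none => 0
  | none, some (l, a) => if a.1.1 = 1 then P l 1 else Q l (n - 1)
  | some (l, a), none => if a.1.1 = 1 then Q l 0 else P l n
  | some (_, a), some (l, b) => if a.1.1 < b.1.1 then P l b.1.1 else Q l b.1.1

/-- Pairs that are not arcs also get 0 or a value of P or Q at an index at most n, so the bound
covers all pairs, as `hittingMatrix_of_firstStep` requires. -/
theorem arcFun_nonneg {P Q : Fin k → ℕ → ℝ} (hP : ∀ l, ∀ m ≤ n, 0 ≤ P l m)
    (hQ : ∀ l, ∀ m ≤ n, 0 ≤ Q l m) (hn : 3 ≤ n) (u v : PinwheelVertex n k) :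
    0 ≤ arcFun P Q u v := by
  rcases u with _ | ⟨l, a⟩ <;> rcases v with _ | ⟨l', b⟩ <;> simp only [arcFun]
  · exact le_rfl
  · split_ifs
    exacts [hP _ _ (by omega), hQ _ _ (by omega)]
  · split_ifs
    exacts [hQ _ _ (by omega), hP _ _ le_rfl]
  · have := b.1.2
    split_ifs
    exacts [hP _ _ (by omega), hQ _ _ (by omega)]

/-- As n ≥ 3, positions 1 and n - 1 differ, so the direction of an arc at the hub can be read from
its other endpoint. -/
theorem arcFun_up (hn : 3 ≤ n) (P Q : Fin k → ℕ → ℝ) (l : Fin k) {m : ℕ} (hm : m < n) :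
    arcFun P Q (pos l m : PinwheelVertex n k) (pos l (m + 1)) = P l (m + 1) := by
  rcases Nat.eq_zero_or_pos m with rfl | h0
  · rw [pos_zero, pos, dif_pos (by omega)]
    simp [arcFun]
  · rcases Nat.lt_or_ge (m + 1) n with h | h
    · rw [pos, dif_pos (by omega), pos, dif_pos (by omega)]
      simp [arcFun]
    · obtain rfl : n = m + 1 := by omega
      rw [pos_self, pos, dif_pos (by omega)]
      simp only [arcFun]
      rw [if_neg (by omega)]

theorem arcFun_down (hn : 3 ≤ n) (P Q : Fin k → ℕ → ℝ) (l : Fin k) {m : ℕ} (hm : m < n) :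
    arcFun P Q (pos l (m + 1) : PinwheelVertex n k) (pos l m) = Q l m := by
  rcases Nat.eq_zero_or_pos m with rfl | h0
  · rw [pos_zero, pos, dif_pos (by omega)]
    simp [arcFun]
  · rcases Nat.lt_or_ge (m + 1) n with h | h
    · rw [pos, dif_pos (by omega), pos, dif_pos (by omega)]
      simp [arcFun]
    · obtain rfl : n = m + 1 := by omega
      rw [pos_self, pos, dif_pos (by omega)]
      simp only [arcFun]
      rw [if_neg (by omega), Nat.add_sub_cancel]

/-- The first-step equations for hitting `j`, in terms of the values `P l m` and `Q l m` on the
arcs into position `m` of the `l`-th cycle from position `m - 1` and from position `m + 1`. -/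
structure IsArcSolution (j : PinwheelVertex n k) (P Q : Fin k → ℕ → ℝ) : Prop where
  up_nonneg : ∀ l, ∀ m ≤ n, 0 ≤ P l m
  down_nonneg : ∀ l, ∀ m ≤ n, 0 ≤ Q l m
  up_target : ∀ l, ∀ m < n, pos l (m + 1) = j → P l (m + 1) = 0
  down_target : ∀ l, ∀ m < n, pos l m = j → Q l m = 0
  up_step : ∀ l m, m + 1 < n → pos l (m + 1) ≠ j → P l (m + 1) = 1 + P l (m + 2)
  down_step : ∀ l m, m + 1 < n → pos l (m + 1) ≠ j → Q l (m + 1) = 1 + Q l m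
  up_hub : none ≠ j → ∀ l,
    P l n = 1 + ((∑ l', (P l' 1 + Q l' (n - 1))) - Q l (n - 1)) / (2 * k - 1)
  down_hub : none ≠ j → ∀ l,
    Q l 0 = 1 + ((∑ l', (P l' 1 + Q l' (n - 1))) - P l 1) / (2 * k - 1)

theorem sum_arcFun_hub (hn : 3 ≤ n) (P Q : Fin k → ℕ → ℝ) :
    ∑ w ∈ (pinwheel n k).neighborFinset none, arcFun P Q none w =
      ∑ l, (P l 1 + Q l (n - 1)) := by
  rw [sum_neighborFinset_hub hn]
  refine Finset.sum_congr rfl fun l _ => ?_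
  have h1 := arcFun_up hn P Q l (m := 0) (by omega)
  have h2 := arcFun_down hn P Q l (m := n - 1) (by omega)
  rw [pos_zero] at h1
  rw [Nat.sub_add_cancel (by omega), pos_self] at h2
  rw [h1, h2]

/-- The sum over permitted successors is the full neighbour sum minus the value on the reversed arc.
At a non-hub vertex one term survives; at the hub this is the subtraction in `up_hub` and
`down_hub`. -/
theorem IsArcSolution.firstStep (hn : 3 ≤ n) (hk : 1 ≤ k) {j : PinwheelVertex n k}
    {P Q : Fin k → ℕ → ℝ} (h : IsArcSolution j P Q) {u v : PinwheelVertex n k}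
    (huv : (pinwheel n k).Adj u v) (hv : v ≠ j) :
    arcFun P Q u v = 1 + (∑ w ∈ ((pinwheel n k).neighborFinset v).erase u, arcFun P Q v w) /
      ((((pinwheel n k).neighborFinset v).erase u).card : ℝ) := by
  have hmem : u ∈ (pinwheel n k).neighborFinset v := by simpa using huv.symm
  have hcard := Finset.card_erase_of_mem hmem
  have hsum := Finset.sum_erase_eq_sub (f := arcFun P Q v) hmem
  rw [hcard, hsum]
  rw [pinwheel_adj_iff hn] at huv
  have hcast : ((2 * k - 1 : ℕ) : ℝ) = 2 * k - 1 := by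
    rw [Nat.cast_sub (by omega)]
    simp
  obtain ⟨l, m, hm, ⟨rfl, rfl⟩ | ⟨rfl, rfl⟩⟩ := huv
  · rw [arcFun_up hn P Q l hm]
    rcases Nat.lt_or_ge (m + 1) n with h1 | h1
    · rw [h.up_step l m h1 hv, card_neighborFinset_pos hn l h1, neighborFinset_pos hn l h1,
        Finset.sum_pair (pos_ne_pos_add_two hn l h1), arcFun_up hn P Q l h1]
      simp
    · obtain rfl : n = m + 1 := by omega
      have h2 := arcFun_down hn P Q l hm
      rw [pos_self] at hv h2 ⊢
      rw [h.up_hub hv l, card_neighborFinset_hub hn, sum_arcFun_hub hn, h2, hcast,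
        Nat.add_sub_cancel]
  · rw [arcFun_down hn P Q l hm]
    rcases Nat.eq_zero_or_pos m with rfl | h0
    · have h2 := arcFun_up hn P Q l hm
      rw [pos_zero] at hv h2 ⊢
      rw [h.down_hub hv l, card_neighborFinset_hub hn, sum_arcFun_hub hn, h2, hcast]
    · obtain ⟨m, rfl⟩ := Nat.exists_eq_succ_of_ne_zero h0.ne'
      rw [Nat.succ_eq_add_one] at *
      rw [h.down_step l m hm hv, card_neighborFinset_pos hn l hm, neighborFinset_pos hn l hm,
        Finset.sum_pair (pos_ne_pos_add_two hn l hm), arcFun_down hn P Q l (by omega)]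
      simp

theorem IsArcSolution.hittingMatrix_eq (hn : 3 ≤ n) (hk : 1 ≤ k) {i j : PinwheelVertex n k}
    {P Q : Fin k → ℕ → ℝ} (h : IsArcSolution j P Q) (hij : i ≠ j) :
    hittingMatrix (pinwheel n k) i j = ENNReal.ofReal (1 +
      (∑ w ∈ (pinwheel n k).neighborFinset i, arcFun P Q i w) /
        (((pinwheel n k).neighborFinset i).card : ℝ)) := by
  have h2 := two_le_card_neighborFinset hn hk
  refine hittingMatrix_of_firstStep (pinwheel n k)
    (fun v => Finset.card_pos.1 (by have := h2 v; omega)) (fun u v huv => ?_) hij (arcFun P Q)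
    (arcFun_nonneg h.up_nonneg h.down_nonneg hn) (fun u hu => ?_)
    fun u v huv hv => h.firstStep hn hk huv hv
  · rw [← Finset.card_pos, Finset.card_erase_of_mem (by simpa using huv.symm)]
    have := h2 v
    omega
  · rw [pinwheel_adj_iff hn] at hu
    obtain ⟨l, m, hm, ⟨rfl, hj⟩ | ⟨rfl, hj⟩⟩ := hu
    · rw [hj, arcFun_up hn P Q l hm, h.up_target l m hm hj.symm]
    · rw [hj, arcFun_down hn P Q l hm, h.down_target l m hm hj.symm]

theorem IsArcSolution.nonneg_sum (hn : 3 ≤ n) {j : PinwheelVertex n k}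
    {P Q : Fin k → ℕ → ℝ} (h : IsArcSolution j P Q) (i : PinwheelVertex n k) :
    0 ≤ 1 + (∑ w ∈ (pinwheel n k).neighborFinset i, arcFun P Q i w) /
        (((pinwheel n k).neighborFinset i).card : ℝ) :=
  add_nonneg zero_le_one (div_nonneg (Finset.sum_nonneg fun w _ =>
    arcFun_nonneg h.up_nonneg h.down_nonneg hn i w) (Nat.cast_nonneg _))

theorem IsArcSolution.toReal_hub (hn : 3 ≤ n) (hk : 1 ≤ k) {j : PinwheelVertex n k}
    {P Q : Fin k → ℕ → ℝ} (h : IsArcSolution j P Q) (hj : none ≠ j) :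
    (hittingMatrix (pinwheel n k) none j).toReal =
      1 + (∑ l, (P l 1 + Q l (n - 1))) / (2 * k) := by
  rw [h.hittingMatrix_eq hn hk hj, ENNReal.toReal_ofReal (h.nonneg_sum hn none),
    sum_arcFun_hub hn, card_neighborFinset_hub hn]
  push_cast
  rfl

theorem IsArcSolution.toReal_pos (hn : 3 ≤ n) (hk : 1 ≤ k) {j : PinwheelVertex n k}
    {P Q : Fin k → ℕ → ℝ} (h : IsArcSolution j P Q) (l : Fin k) {m : ℕ} (hm : m + 1 < n)
    (hj : pos l (m + 1) ≠ j) :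
    (hittingMatrix (pinwheel n k) (pos l (m + 1)) j).toReal = 1 + (Q l m + P l (m + 2)) / 2 := by
  rw [h.hittingMatrix_eq hn hk hj, ENNReal.toReal_ofReal (h.nonneg_sum hn _),
    card_neighborFinset_pos hn l hm, neighborFinset_pos hn l hm,
    Finset.sum_pair (pos_ne_pos_add_two hn l hm), arcFun_up hn P Q l hm,
    arcFun_down hn P Q l (by omega)]
  push_cast
  rfl

end Pinwheel

/-! ### Explicit solutions for each target -/

section Solutions

variable {n k : ℕ}

/-- With the hub as target the walk is deterministic after its first step, and the remaining time is
the distance ahead. -/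
theorem isArcSolution_hub :
    IsArcSolution (none : PinwheelVertex n k) (fun _ m => (n : ℝ) - m) (fun _ m => (m : ℝ)) where
  up_nonneg _ m hm := sub_nonneg.2 (by exact_mod_cast hm)
  down_nonneg _ m _ := Nat.cast_nonneg m
  up_target l m hm h := by
    obtain h | h := (pos_eq_none (by omega)).1 h
    · omega
    · rw [h, sub_self]
  down_target l m hm h := by
    obtain h | h := (pos_eq_none hm.le).1 h
    · rw [h, Nat.cast_zero]
    · omega
  up_step l m _ _ := by
    push_cast
    ring
  down_step l m _ _ := by
    push_cast
    ring
  up_hub h := absurd rfl h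
  down_hub h := absurd rfl h

theorem sum_ite_eq_add {k : ℕ} (l₀ : Fin k) (A B : ℝ) :
    ∑ l, (if l = l₀ then A else B) = A + (k - 1) * B := by
  have : ∀ l, (if l = l₀ then A else B) = B + if l = l₀ then A - B else 0 := by
    intro l
    split_ifs <;> ring
  simp_rw [this]
  rw [Finset.sum_add_distrib, Finset.sum_ite_eq' Finset.univ l₀ fun _ => A - B]
  simp
  ring

/-- Mean time from an arc into position `m` (coming from `m - 1`) of cycle `l` to position `b` of
cycle `l₀`. -/
noncomputable def upTime (n : ℕ) (l₀ : Fin k) (b : ℕ) (l : Fin k) (m : ℕ) : ℝ :=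
  if l = l₀ then
    if m ≤ b then (b : ℝ) - m
    else (n : ℝ) - m + (b + (2 * k - 2) * (n * k)) / (2 * k - 1)
  else (n : ℝ) - m + n * (k - 1)

/-- Mean time from an arc into position `m` (coming from `m + 1`) of cycle `l` to position `b` of
cycle `l₀`. -/
noncomputable def downTime (n : ℕ) (l₀ : Fin k) (b : ℕ) (l : Fin k) (m : ℕ) : ℝ :=
  if l = l₀ then
    if b ≤ m then (m : ℝ) - b
    else (m : ℝ) + ((n - b) + (2 * k - 2) * (n * k)) / (2 * k - 1)
  else (m : ℝ) + n * (k - 1)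

/-- The two arcs leaving the hub into the target's cycle contribute b - 1 and n - 1 - b, so b
cancels. -/
theorem sum_upTime_add_downTime (hn : 3 ≤ n) (l₀ : Fin k) {b : ℕ} (h0 : 0 < b) (hb : b < n) :
    ∑ l, (upTime n l₀ b l 1 + downTime n l₀ b l (n - 1)) =
      (n - 2) + (k - 1) * (2 * (n - 1 + n * (k - 1))) := by
  have hc : ((n - 1 : ℕ) : ℝ) = n - 1 := by
    rw [Nat.cast_sub (by omega), Nat.cast_one]
  rw [← sum_ite_eq_add l₀]
  refine Finset.sum_congr rfl fun l _ => ?_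
  simp only [upTime, downTime]
  rw [if_pos (show 1 ≤ b by omega), if_pos (show b ≤ n - 1 by omega), hc]
  split_ifs <;> push_cast <;> ring

/-- Let T be the remaining time on reaching the hub from another cycle. Entering such a cycle costs
n + T from the hub, and the hub equation (2k-1)T = n + (2k-3)(n+T) gives T = n(k-1), so n + T = nk.
A walker reaching the hub upwards along the target's cycle cannot turn back: one choice reaches the
target in b steps and the other 2k - 2 cost nk each. Downwards, n - b replaces b. -/
theorem isArcSolution_pos (hn : 3 ≤ n) (l₀ : Fin k) {b : ℕ} (h0 : 0 < b) (hb : b < n) :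
    IsArcSolution (pos l₀ b : PinwheelVertex n k) (upTime n l₀ b) (downTime n l₀ b) := by
  have hk : (1 : ℝ) ≤ k := by exact_mod_cast (show 1 ≤ k from l₀.pos)
  have hk' : (0 : ℝ) < 2 * k - 1 := by linarith
  have hk'' := hk'.ne'
  have hbn : (b : ℝ) ≤ n := by exact_mod_cast hb.le
  have hC : 0 ≤ (2 * k - 2 : ℝ) * (n * k) := mul_nonneg (by linarith) (by positivity)
  have hT : 0 ≤ (n : ℝ) * (k - 1) := mul_nonneg (by positivity) (by linarith)
  have hc : ((n - 1 : ℕ) : ℝ) = n - 1 := by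
    rw [Nat.cast_sub (by omega), Nat.cast_one]
  have hs := sum_upTime_add_downTime hn l₀ h0 hb
  refine ⟨?_, ?_, ?_, ?_, ?_, ?_, ?_, ?_⟩
  · intro l m hm
    have hm' : (m : ℝ) ≤ n := by exact_mod_cast hm
    rw [upTime]
    split_ifs with h1 h2
    · exact sub_nonneg.2 (by exact_mod_cast h2)
    · exact add_nonneg (by linarith) (div_nonneg (by positivity) hk'.le)
    · linarith
  · intro l m hm
    rw [downTime]
    split_ifs with h1 h2
    · exact sub_nonneg.2 (by exact_mod_cast h2)
    · exact add_nonneg (by positivity) (div_nonneg (by linarith) hk'.le)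
    · positivity
  · intro l m hm h
    obtain ⟨rfl, rfl⟩ := (pos_eq_pos h0 hb).1 h.symm
    simp [upTime]
  · intro l m hm h
    obtain ⟨rfl, rfl⟩ := (pos_eq_pos h0 hb).1 h.symm
    simp [downTime]
  · intro l m hm h
    rw [Ne, pos_eq_pos (Nat.succ_pos m) hm] at h
    simp only [upTime]
    split_ifs with h1 h2 h3 h3
    · push_cast
      ring
    · exact absurd ⟨h1, by omega⟩ h
    · omega
    · push_cast
      ring
    · push_cast
      ring
  · intro l m hm h
    rw [Ne, pos_eq_pos (Nat.succ_pos m) hm] at h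
    simp only [downTime]
    split_ifs with h1 h2 h3 h3
    · push_cast
      ring
    · exact absurd ⟨h1, by omega⟩ h
    · omega
    · push_cast
      ring
    · push_cast
      ring
  · intro _ l
    rw [hs]
    simp only [upTime, downTime]
    rw [if_neg (show ¬ n ≤ b by omega), if_pos (show b ≤ n - 1 by omega), hc]
    split_ifs
    · field_simp
      ring
    · rw [← sub_eq_iff_eq_add', eq_div_iff hk'']
      ring
  · intro _ l
    rw [hs]
    simp only [upTime, downTime]
    rw [if_neg (show ¬ b ≤ 0 by omega), if_pos (show 1 ≤ b by omega)]
    split_ifs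
    · push_cast
      field_simp
      ring
    · rw [← sub_eq_iff_eq_add', eq_div_iff hk'']
      push_cast
      ring

/-! ### Closed forms of the mean hitting times -/

theorem hittingMatrix_pos_hub (hn : 3 ≤ n) (hk : 1 ≤ k) (l : Fin k) {m : ℕ} (hm : m + 1 < n) :
    (hittingMatrix (pinwheel n k) (pos l (m + 1)) none).toReal = n / 2 := by
  rw [isArcSolution_hub.toReal_pos hn hk l hm]
  · push_cast
    ring
  · rw [Ne, pos_eq_none hm.le]
    omega

theorem hittingMatrix_hub_pos (hn : 3 ≤ n) (hk : 1 ≤ k) (l : Fin k) {m : ℕ} (hm : m + 1 < n) :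
    (hittingMatrix (pinwheel n k) none (pos l (m + 1))).toReal = n / (2 * k) + (k - 1) * n := by
  have hk' : (k : ℝ) ≠ 0 := by exact_mod_cast (show k ≠ 0 by omega)
  rw [(isArcSolution_pos hn l (Nat.succ_pos m) hm).toReal_hub hn hk,
    sum_upTime_add_downTime hn l (Nat.succ_pos m) hm]
  · field_simp
    ring
  · rw [ne_comm, Ne, pos_eq_none hm.le]
    omega

/-- The mean hitting time between vertices of different cycles, and of the same cycle. -/
theorem hittingMatrix_pos_pos (hn : 3 ≤ n) (hk : 1 ≤ k) (l l' : Fin k) {a b : ℕ}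
    (ha : a + 1 < n) (hb : b + 1 < n) :
    (hittingMatrix (pinwheel n k) (pos l (a + 1)) (pos l' (b + 1))).toReal =
      (if l = l' then
        if a < b then ((b + 1) + ((n - (b + 1)) + (2 * k - 2) * (n * k)) / (2 * k - 1)) / 2
        else if a = b then 0
        else (n - (b + 1) + ((b + 1) + (2 * k - 2) * (n * k)) / (2 * k - 1)) / 2
      else n / 2 + n * (k - 1) : ℝ) := by
  by_cases hab : l = l' ∧ a = b
  · obtain ⟨rfl, rfl⟩ := hab
    simp [hittingMatrix]
  · rw [(isArcSolution_pos hn l' (Nat.succ_pos b) hb).toReal_pos hn hk l ha]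
    -- For a < b on one cycle, the direct way takes b - a steps and the other way a + 1 steps to the
    -- hub plus a constant, so a cancels; symmetrically for a > b.
    · simp only [upTime, downTime]
      split_ifs <;> first
        | omega
        | (push_cast; ring)
    · rw [Ne, pos_eq_pos (Nat.succ_pos a) ha]
      omega

theorem hittingMatrix_ne_top (hn : 3 ≤ n) (hk : 1 ≤ k) (i j : PinwheelVertex n k) :
    hittingMatrix (pinwheel n k) i j ≠ ⊤ := by
  by_cases hij : i = j
  · simp [hittingMatrix, hij]
  · obtain rfl | ⟨l, m, hm, rfl⟩ := eq_none_or_pos j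
    · rw [isArcSolution_hub.hittingMatrix_eq hn hk hij]
      exact ENNReal.ofReal_ne_top
    · rw [(isArcSolution_pos hn l (Nat.succ_pos m) hm).hittingMatrix_eq hn hk hij]
      exact ENNReal.ofReal_ne_top

/-! ### Stationary weights and sums of hitting times -/

theorem sum_pinwheelVertex {M : Type*} [AddCommMonoid M] (hn : 3 ≤ n)
    (g : PinwheelVertex n k → M) :
    ∑ v, g v = g none + ∑ l : Fin k, ∑ m ∈ Finset.range (n - 1), g (pos l (m + 1)) := by
  rw [Fintype.sum_option, Fintype.sum_prod_type]
  congr 1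
  refine Finset.sum_congr rfl fun l _ => ?_
  refine Finset.sum_bij' (fun a _ => a.1.1 - 1)
    (fun m hm => ⟨⟨m + 1, by have := Finset.mem_range.1 hm; omega⟩, by simp⟩) ?_ ?_ ?_ ?_ ?_
  · intro a _
    have := a.2
    have := a.1.2
    exact Finset.mem_range.2 (by omega)
  · simp
  · intro a _
    have := a.2
    ext
    simp only
    omega
  · simp
  · intro a _
    have := a.2
    rw [Nat.sub_add_cancel (by omega), pos_val]

theorem two_mul_card_edgeFinset (hn : 3 ≤ n) :
    (2 * (pinwheel n k).edgeFinset.card : ℝ) = 2 * k * n := by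
  have h := (pinwheel n k).sum_degrees_eq_twice_card_edges
  rw [sum_pinwheelVertex hn, ← SimpleGraph.card_neighborFinset_eq_degree,
    card_neighborFinset_hub hn] at h
  have h2 : ∀ l : Fin k, ∑ m ∈ Finset.range (n - 1), (pinwheel n k).degree (pos l (m + 1)) =
      (n - 1) * 2 := by
    intro l
    rw [Finset.sum_congr rfl (g := fun _ => 2)]
    · simp
    · intro m hm
      rw [← SimpleGraph.card_neighborFinset_eq_degree,
        card_neighborFinset_pos hn l (by have := Finset.mem_range.1 hm; omega)]
  simp only [h2, Finset.sum_const, Finset.card_univ, Fintype.card_fin, smul_eq_mul] at h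
  obtain ⟨N, rfl⟩ : ∃ N, n = N + 1 := ⟨n - 1, by omega⟩
  rw [Nat.add_sub_cancel] at h
  have h' := congrArg (Nat.cast : ℕ → ℝ) h
  push_cast at h' ⊢
  linarith

theorem stationary_hub (hn : 3 ≤ n) (hk : 1 ≤ k) :
    stationary (pinwheel n k) none = 1 / n := by
  have hk' : (k : ℝ) ≠ 0 := by exact_mod_cast (show k ≠ 0 by omega)
  have hn' : (n : ℝ) ≠ 0 := by exact_mod_cast (show n ≠ 0 by omega)
  rw [stationary, two_mul_card_edgeFinset hn, ← SimpleGraph.card_neighborFinset_eq_degree,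
    card_neighborFinset_hub hn]
  push_cast
  field_simp

theorem stationary_pos (hn : 3 ≤ n) (hk : 1 ≤ k) (l : Fin k) {m : ℕ} (hm : m + 1 < n) :
    stationary (pinwheel n k) (pos l (m + 1)) = 1 / (k * n) := by
  have hk' : (k : ℝ) ≠ 0 := by exact_mod_cast (show k ≠ 0 by omega)
  have hn' : (n : ℝ) ≠ 0 := by exact_mod_cast (show n ≠ 0 by omega)
  rw [stationary, two_mul_card_edgeFinset hn, ← SimpleGraph.card_neighborFinset_eq_degree,
    card_neighborFinset_pos hn l hm]
  push_cast
  field_simp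

theorem sum_range_trichotomy {N b : ℕ} (hb : b < N) (X Y : ℝ) :
    ∑ a ∈ Finset.range N, (if a < b then X else if a = b then 0 else Y) =
      b * X + (N - 1 - b) * Y := by
  obtain ⟨c, rfl⟩ : ∃ c, N = b + (1 + c) := ⟨N - b - 1, by omega⟩
  rw [Finset.sum_range_add, Finset.sum_range_add]
  have h1 : ∑ a ∈ Finset.range b, (if a < b then X else if a = b then 0 else Y) = b * X := by
    rw [Finset.sum_congr rfl fun a ha => if_pos (Finset.mem_range.1 ha)]
    simp
  rw [h1]
  have h2 : ∀ x, ¬ (b + (1 + x) < b) := fun x => by omega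
  have h3 : ∀ x, ¬ (b + (1 + x) = b) := fun x => by omega
  simp [h2]
  left
  ring

theorem sum_range_quadratic (N : ℕ) (α β γ : ℝ) :
    ∑ m ∈ Finset.range N, (α + β * m + γ * m ^ 2) =
      α * N + β * (N * (N - 1) / 2) + γ * (N * (N - 1) * (2 * N - 1) / 6) := by
  induction N with
  | zero => simp
  | succ N ih =>
    rw [Finset.sum_range_succ, ih]
    push_cast
    ring

/-- The sum of the mean hitting times between vertices of one cycle other than the hub. -/
theorem sum_hittingMatrix_same (hn : 3 ≤ n) (hk : 1 ≤ k) (l : Fin k) :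
    ∑ a ∈ Finset.range (n - 1), ∑ b ∈ Finset.range (n - 1),
      (hittingMatrix (pinwheel n k) (pos l (a + 1)) (pos l (b + 1))).toReal =
      ((n - 1) * (n - 2) / 2 : ℝ) * (2 * n / 3 + (n / 3 + (2 * k - 2) * (n * k)) / (2 * k - 1)) := by
  have hk' : (2 * k - 1 : ℝ) ≠ 0 := by
    have : (1 : ℝ) ≤ k := by exact_mod_cast hk
    linarith
  -- For a fixed target the summand depends only on the side of the start, so the sum over starts is
  -- done first.
  rw [Finset.sum_comm]
  obtain ⟨N, rfl⟩ : ∃ N, n = N + 1 := ⟨n - 1, by omega⟩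
  rw [Nat.add_sub_cancel]
  set D : ℝ := (2 * k - 2) * ((N + 1) * k) with hD
  -- There are b starts below the target and N - 1 - b above, each with a value affine in b: the
  -- result is quadratic in b.
  rw [Finset.sum_congr rfl (g := fun b : ℕ =>
    ((N - 1) * (N + (1 + D) / (2 * k - 1)) / 2 : ℝ) + ((1 - N) * (1 - 1 / (2 * k - 1))) * b +
      (1 - 1 / (2 * k - 1)) * (b : ℝ) ^ 2)]
  · rw [sum_range_quadratic]
    push_cast
    rw [← hD]
    field_simp
    ring
  · intro b hb
    have hb' := Finset.mem_range.1 hb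
    rw [Finset.sum_congr rfl fun a ha => by
      rw [hittingMatrix_pos_pos hn hk l l (by have := Finset.mem_range.1 ha; omega)
        (by omega), if_pos rfl], sum_range_trichotomy hb']
    push_cast
    rw [← hD]
    field_simp
    ring

/-- The sum of the mean hitting times between vertices, other than the hub, of two cycles. -/
theorem sum_hittingMatrix_pos_pos (hn : 3 ≤ n) (hk : 1 ≤ k) :
    ∑ l : Fin k, ∑ a ∈ Finset.range (n - 1), ∑ l' : Fin k, ∑ b ∈ Finset.range (n - 1),
      (hittingMatrix (pinwheel n k) (pos l (a + 1)) (pos l' (b + 1))).toReal =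
      k * (((n - 1) * (n - 2) / 2 : ℝ) *
        (2 * n / 3 + (n / 3 + (2 * k - 2) * (n * k)) / (2 * k - 1)) +
        (k - 1) * ((n - 1) ^ 2 * (n / 2 + n * (k - 1)))) := by
  have hc : ((n - 1 : ℕ) : ℝ) = n - 1 := by
    rw [Nat.cast_sub (by omega), Nat.cast_one]
  have h : ∀ l : Fin k, ∑ a ∈ Finset.range (n - 1), ∑ l' : Fin k, ∑ b ∈ Finset.range (n - 1),
      (hittingMatrix (pinwheel n k) (pos l (a + 1)) (pos l' (b + 1))).toReal =
      ((n - 1) * (n - 2) / 2 : ℝ) *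
        (2 * n / 3 + (n / 3 + (2 * k - 2) * (n * k)) / (2 * k - 1)) +
        (k - 1) * ((n - 1) ^ 2 * (n / 2 + n * (k - 1))) := by
    intro l
    rw [Finset.sum_comm, ← sum_ite_eq_add l]
    refine Finset.sum_congr rfl fun l' _ => ?_
    split_ifs with hl
    · rw [hl, sum_hittingMatrix_same hn hk]
    · rw [Finset.sum_congr rfl (g := fun _ => ((n : ℝ) - 1) * (n / 2 + n * (k - 1)))]
      · rw [Finset.sum_const, Finset.card_range, nsmul_eq_mul, hc]
        ring
      · intro a ha
        have ha' := Finset.mem_range.1 ha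
        rw [Finset.sum_congr rfl (g := fun _ => ((n : ℝ) / 2 + n * (k - 1)))]
        · rw [Finset.sum_const, Finset.card_range, nsmul_eq_mul, hc]
        · intro b hb
          have hb' := Finset.mem_range.1 hb
          rw [hittingMatrix_pos_pos hn hk l l' (by omega) (by omega), if_neg (Ne.symm hl)]
  simp only [h, Finset.sum_const, Finset.card_univ, Fintype.card_fin, nsmul_eq_mul]

end Solutions

end NBRW

/-! ### Assembling the bilinear form -/

open NBRW

theorem mainTheorem11 (n k : ℕ) (hn : 3 ≤ n) (hk : 1 ≤ k) :
    (∀ i j : NBRW.PinwheelVertex n k, NBRW.hittingMatrix (NBRW.pinwheel n k) i j ≠ ⊤) ∧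
    NBRW.stationary (NBRW.pinwheel n k) ⬝ᵥ
        ((NBRW.hittingMatrix (NBRW.pinwheel n k)).map ENNReal.toReal *ᵥ
          NBRW.stationary (NBRW.pinwheel n k)) =
      (((n : ℝ) - 1) * (12 * (k : ℝ) ^ 3 * n - 18 * (k : ℝ) ^ 2 * n + 13 * k * n
          - 2 * k - 4 * n + 2)) /
        (6 * (k : ℝ) * n * (2 * k - 1)) := by
  refine ⟨hittingMatrix_ne_top hn hk, ?_⟩
  have hc : ((n - 1 : ℕ) : ℝ) = n - 1 := by
    rw [Nat.cast_sub (by omega), Nat.cast_one]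
  have hk0 : (k : ℝ) ≠ 0 := by exact_mod_cast (show k ≠ 0 by omega)
  have hn0 : (n : ℝ) ≠ 0 := by exact_mod_cast (show n ≠ 0 by omega)
  have hk1 : (k * 2 - 1 : ℝ) ≠ 0 := by
    have : (1 : ℝ) ≤ k := by exact_mod_cast hk
    linarith
  set p : ℝ := 1 / (k * n) with hp
  have hpos : ∀ (l : Fin k), ∀ m ∈ Finset.range (n - 1),
      stationary (pinwheel n k) (pos l (m + 1)) = p := fun l m hm =>
    stationary_pos hn hk l (by have := Finset.mem_range.1 hm; omega)
  have hrow : ∀ i : PinwheelVertex n k, ((hittingMatrix (pinwheel n k)).map ENNReal.toReal *ᵥ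
      stationary (pinwheel n k)) i = (hittingMatrix (pinwheel n k) i none).toReal * (1 / n) +
        (∑ l : Fin k, ∑ m ∈ Finset.range (n - 1),
          (hittingMatrix (pinwheel n k) i (pos l (m + 1))).toReal) * p := by
    intro i
    rw [Matrix.mulVec, dotProduct, sum_pinwheelVertex hn, stationary_hub hn hk, Finset.sum_mul]
    simp only [Matrix.map_apply]
    congr 1
    refine Finset.sum_congr rfl fun l _ => ?_
    rw [Finset.sum_mul]
    exact Finset.sum_congr rfl fun m hm => by rw [hpos l m hm]
  have hhub : ∑ l : Fin k, ∑ m ∈ Finset.range (n - 1),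
      (hittingMatrix (pinwheel n k) none (pos l (m + 1))).toReal =
        k * ((n - 1) * (n / (2 * k) + (k - 1) * n)) := by
    rw [Finset.sum_congr rfl fun l _ => Finset.sum_congr rfl fun m hm =>
      hittingMatrix_hub_pos hn hk l (by have := Finset.mem_range.1 hm; omega)]
    simp only [hc, Finset.sum_const, Finset.card_univ, Finset.card_range, Fintype.card_fin,
      nsmul_eq_mul]
  have hback : ∑ l : Fin k, ∑ m ∈ Finset.range (n - 1),
      (hittingMatrix (pinwheel n k) (pos l (m + 1)) none).toReal = k * ((n - 1) * (n / 2)) := by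
    rw [Finset.sum_congr rfl fun l _ => Finset.sum_congr rfl fun m hm =>
      hittingMatrix_pos_hub hn hk l (by have := Finset.mem_range.1 hm; omega)]
    simp only [hc, Finset.sum_const, Finset.card_univ, Finset.card_range, Fintype.card_fin,
      nsmul_eq_mul]
  have hself : (hittingMatrix (pinwheel n k) none none).toReal = 0 := by simp [hittingMatrix]
  -- Off the hub the stationary weight is the constant p, so it factors out and leaves the sums
  -- already evaluated.
  have hrest : ∑ l : Fin k, ∑ m ∈ Finset.range (n - 1),
      stationary (pinwheel n k) (pos l (m + 1)) *
        ((hittingMatrix (pinwheel n k) (pos l (m + 1)) none).toReal * (1 / n) +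
        (∑ l' : Fin k, ∑ b ∈ Finset.range (n - 1),
          (hittingMatrix (pinwheel n k) (pos l (m + 1)) (pos l' (b + 1))).toReal) * p) =
      p * (k * ((n - 1) * (n / 2)) * (1 / n) + k * (((n - 1) * (n - 2) / 2 : ℝ) *
        (2 * n / 3 + (n / 3 + (2 * k - 2) * (n * k)) / (2 * k - 1)) +
        (k - 1) * ((n - 1) ^ 2 * (n / 2 + n * (k - 1)))) * p) := by
    rw [Finset.sum_congr rfl fun l _ => Finset.sum_congr rfl fun m hm => by rw [hpos l m hm],
      ← hback, ← sum_hittingMatrix_pos_pos hn hk]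
    simp only [Finset.mul_sum, Finset.sum_mul, mul_add, Finset.sum_add_distrib]
  rw [dotProduct, sum_pinwheelVertex hn]
  simp only [hrow]
  rw [stationary_hub hn hk, hself, hhub, hrest, hp]
  field_simp
  ring
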